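/- **Model.** Let $c\ge 0$ be real and $S_c=\{d\in\mathbb Z^2:\|d\|_2\le c\}$. A *field* is a map $f:(\mathbb Z/k)^2\to\{0,1\}$; all $2^{k^2}$ fields are equally likely. For $h\in(\mathbb Z/k)^2$, the *pattern* of $f$ at $h$ is $(f(h+d))_{d\in S_c}\in\{0,1\}^{S_c}$ (circular boundary). Let $\mathcal X,\mathcal Y$ be finite sets, $\Psi:\{0,1\}^{S_c}\to\mathcal X$ any function and $P_{Y|X}$ a conditional p.m.f. A *sensor network* is a choice of locations $h_1,\dots,h_n\in(\mathbb Z/k)^2$; sensor $\ell$ has ideal output $x_\ell=\Psi(\text{pattern of }f\text{ at }h_\ell)$ and, independently given $f$, noisy output $y_\ell\sim P_{Y|X}(\cdot|x_\ell)$. A detector $g:\mathcal Y^n\to\{0,1\}^{(\mathbb Z/k)^2}$ is in error at distortion $D\in[0,1]$ if $\frac1{k^2}d_H(f,g(y))\ge D$. The expected error probability of a network with a detector is its error probability averaged over the equally likely fields $f$ and over the noise. At rate $R>0$, $n$ sensors observe a $k\times k$ field with $k=\lceil\sqrt{nR}\,\rceil$, so that $k^2/n\to R$. The rate $R$ is *achievable*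 if there are networks and detectors for $n=1,2,\dots$ at rate $R$ whose expected error probability tends to $0$ as $n\to\infty$. The *sensing capacity* $C(D)\in[0,\infty]$ is the largest value such that all rates $0<R<C(D)$ are achievable. **Types.** The joint type of two $k\times k$ fields $f_i,f_j$ is $\lambda=(\lambda_{(a)(b)})_{a,b\in\{0,1\}^{S_c}}$, where $\lambda_{(a)(b)}$ is the fraction of positions $h$ at which $f_i$ has pattern $a$ and $f_j$ has pattern $b$. Let $\mathcal P^2$ be the closure of the set of joint types of all pairs of $k\times k$ fields, $k\ge1$. For $\lambda\in\mathcal P^2$ let $\gamma_i,\gamma_j$ be its marginals in $a$ and in $b$, let $\lambda_{(u)(v)}$ be the total mass of the $(a,b)$ whose values at the central offset $0\in S_c$ are $u$ and $v$, and define $\gamma_{i(u)},\gamma_{j(u)}$ similarly. Put $$P^{\gamma_i}_{X_iY}(x,y)=\sum_{a:\Psi(a)=x}\gamma_{i,a}\,P_{Y|X}(y|x),\qquad Q^\lambda_{X_iY}(x,y)=\sum_{x'\in\mathcal X}\ \sum_{a,b:\Psi(a)=x,\Psi(b)=x'}\lambda_{(a)(b)}\,P_{Y|X}(y|x').$$ **Theorem.**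 For every $D\in[0,1]$, the minimum $$C_{LB}(D)=\min_{\substack{\lambda\in\mathcal P^2:\ \lambda_{(0)(1)}+\lambda_{(1)(0)}\ge D,\\ \gamma_{i(0)}=\gamma_{i(1)}=1/2}}\frac{D\big(P^{\gamma_i}_{X_iY}\,\|\,Q^{\lambda}_{X_iY}\big)}{H\big((\gamma_{j(0)},\gamma_{j(1)})\big)}\in[0,\infty]$$ is attained and $C(D)\ge C_{LB}(D)$. Here $D(\cdot\|\cdot)$ is the Kullback–Leibler distance and $H$ the entropy, both with base-2 logarithms, and a quotient with denominator $0$ is $\infty$ if its numerator is positive and $0$ if its numerator is $0$. Moreover, for every rate $0<R<C_{LB}(D)$ there are detectors, depending on the network, such that the expected error probability at rate $R$, averaged over networks whose $n$ sensor locations are chosen independently and uniformly at random, tends to $0$ as $n\to\infty$. -/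

import Mathlib

open Filter Topology
open scoped NNReal ENNReal

noncomputable section

namespace SensorField

/-- A binary target field on the `k × k` grid (`1` = target present, `0` = no target). -/
abbrev Field (k : ℕ) : Type := Fin k × Fin k → Fin 2

/-- The coordinate `x + t` modulo `k`. -/
def wrap {k : ℕ} (x : Fin k) (t : ℤ) : Fin k :=
  ⟨(((x : ℕ) + t) % (k : ℤ)).toNat, by
    have hk : (0 : ℤ) < k := by exact_mod_cast x.pos
    have h0 := Int.emod_nonneg (((x : ℕ) : ℤ) + t) hk.ne'
    have h1 := Int.emod_lt_of_pos (((x : ℕ) : ℤ) + t) hk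
    omega⟩

open scoped Classical in
/-- The offsets `d ∈ ℤ²` of Euclidean length at most `c`: the coverage of a sensor of range `c`,
relative to its location. The enclosing square only serves to make this a `Finset`; see
`mem_coverage`. -/
def coverage (c : ℝ≥0) : Finset (ℤ × ℤ) :=
  (Finset.Icc (-⌊(c : ℝ)⌋) ⌊(c : ℝ)⌋ ×ˢ Finset.Icc (-⌊(c : ℝ)⌋) ⌊(c : ℝ)⌋).filter
    fun d => √((d.1 : ℝ) ^ 2 + (d.2 : ℝ) ^ 2) ≤ c

theorem mem_coverage (c : ℝ≥0) (d : ℤ × ℤ) :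
    d ∈ coverage c ↔ √((d.1 : ℝ) ^ 2 + (d.2 : ℝ) ^ 2) ≤ c := by
  have key : ∀ z : ℤ, |(z : ℝ)| ≤ c → z ∈ Finset.Icc (-⌊(c : ℝ)⌋) ⌊(c : ℝ)⌋ := by
    intro z hz
    have h := abs_le.1 hz
    rw [Finset.mem_Icc]
    refine ⟨?_, Int.le_floor.2 h.2⟩
    have : -z ≤ ⌊(c : ℝ)⌋ := Int.le_floor.2 (by push_cast; linarith [h.1])
    linarith
  unfold coverage
  rw [Finset.mem_filter, Finset.mem_product]
  refine ⟨fun h => h.2, fun h => ⟨⟨key _ ?_, key _ ?_⟩, h⟩⟩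
  · refine le_trans ?_ h
    exact Real.abs_le_sqrt (by nlinarith [sq_nonneg (d.2 : ℝ)])
  · refine le_trans ?_ h
    exact Real.abs_le_sqrt (by nlinarith [sq_nonneg (d.1 : ℝ)])

/-- A bit pattern over the coverage of a sensor of range `c`, an element of `{0,1}^{|S_c|}`. -/
abbrev Pattern (c : ℝ≥0) : Type := coverage c → Fin 2

/-- The sensor's own location inside its coverage. -/
def center (c : ℝ≥0) : coverage c := ⟨(0, 0), by simp [mem_coverage]⟩

/-- The pattern which a sensor located at `h` sees in the field `f` (circular boundary). -/
def patternAt (c : ℝ≥0) {k : ℕ} (f : Field k) (h : Fin k × Fin k) : Pattern c :=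
  fun d => f (wrap h.1 d.1.1, wrap h.2 d.1.2)

/-! ### Sensor networks, error probability, sensing capacity -/

/-- A network of `n` sensors: the grid location of every sensor. -/
abbrev Network (k n : ℕ) : Type := Fin n → Fin k × Fin k

section Network

variable {𝒳 𝒴 : Type*} [Fintype 𝒴] {c : ℝ≥0}

/-- The law `P(y | f, s)` of the sensor outputs: sensor `ℓ` has ideal output `Ψ` of the pattern it
sees, observed through the noise `W = P_{Y|X}`, independently over the sensors. -/
def outputProb (Ψ : Pattern c → 𝒳) (W : 𝒳 → PMF 𝒴) {k n : ℕ} (s : Network k n) (f : Field k)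
    (y : Fin n → 𝒴) : ℝ :=
  ∏ l, (W (Ψ (patternAt c f (s l))) (y l)).toReal

/-- `f'` is in the tolerable distortion region of `f`: normalized Hamming distance less
than `D`. -/
def Tolerable (D : ℝ) {k : ℕ} (f f' : Field k) : Prop :=
  (hammingDist f f' : ℝ) / (k : ℝ) ^ 2 < D

open scoped Classical in
/-- The probability that the detector `g` decides for a field outside the tolerable distortion
region, given that the field `f` occurred. -/
def errorGiven (Ψ : Pattern c → 𝒳) (W : 𝒳 → PMF 𝒴) (D : ℝ) {k n : ℕ} (s : Network k n)
    (g : (Fin n → 𝒴) → Field k) (f : Field k) : ℝ :=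
  ∑ y : Fin n → 𝒴, if Tolerable D f (g y) then 0 else outputProb Ψ W s f y

/-- The expected error probability of the network `s` with detector `g`, all fields being equally
likely. -/
def expectedError (Ψ : Pattern c → 𝒳) (W : 𝒳 → PMF 𝒴) (D : ℝ) {k n : ℕ} (s : Network k n)
    (g : (Fin n → 𝒴) → Field k) : ℝ :=
  (∑ f : Field k, errorGiven Ψ W D s g f) / (Fintype.card (Field k) : ℝ)

/-- The side of the smallest square grid with at least `n * R` positions, so that
`k² / n → R`. -/
def gridSide (R : ℝ) (n : ℕ) : ℕ := ⌈√((n : ℝ) * R)⌉₊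

/-- There are networks of `n` sensors at rate `R` whose expected error probability tends to `0`
as `n → ∞`. -/
def Achievable (Ψ : Pattern c → 𝒳) (W : 𝒳 → PMF 𝒴) (D R : ℝ) : Prop :=
  ∃ (s : ∀ n, Network (gridSide R n) n) (g : ∀ n, (Fin n → 𝒴) → Field (gridSide R n)),
    Tendsto (fun n => expectedError Ψ W D (s n) (g n)) atTop (𝓝 0)

/-- The sensing capacity `C(D)`: the largest rate (possibly `∞`) below which every positive rate is
achievable. -/
def sensingCapacity (Ψ : Pattern c → 𝒳) (W : 𝒳 → PMF 𝒴) (D : ℝ) : ℝ≥0∞ :=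
  sSup {C : ℝ≥0∞ | ∀ R : ℝ, 0 < R → ENNReal.ofReal R < C → Achievable Ψ W D R}

/-- At rate `R`, the expected error probability averaged over the random ensemble, in which every
sensor chooses its location independently and uniformly, tends to `0` as `n → ∞`
(the detector knows the network). -/
def EnsembleAchievable (Ψ : Pattern c → 𝒳) (W : 𝒳 → PMF 𝒴) (D R : ℝ) : Prop :=
  ∃ g : ∀ n, Network (gridSide R n) n → (Fin n → 𝒴) → Field (gridSide R n),
    Tendsto (fun n => (∑ s : Network (gridSide R n) n, expectedError Ψ W D s (g n s)) /
      (Fintype.card (Network (gridSide R n) n) : ℝ)) atTop (𝓝 0)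

end Network

/-! ### Two-dimensional types -/

/-- The two-dimensional joint type of the fields `f`, `f'`: the fraction of grid positions at which
`f` shows the pattern `p.1` while `f'` shows `p.2`. -/
def jointType (c : ℝ≥0) {k : ℕ} (f f' : Field k) (p : Pattern c × Pattern c) : ℝ :=
  (((Finset.univ.filter fun h : Fin k × Fin k =>
      patternAt c f h = p.1 ∧ patternAt c f' h = p.2).card : ℕ) : ℝ) / (k : ℝ) ^ 2

/-- The joint types `P_k²` of `k × k` fields. -/
def jointTypesOfSide (c : ℝ≥0) (k : ℕ) : Set (Pattern c × Pattern c → ℝ) :=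
  {q | ∃ f f' : Field k, q = jointType c f f'}

/-- The joint types `P²` of unrestricted field size: all limits of joint types of finite fields. -/
def jointTypes (c : ℝ≥0) : Set (Pattern c × Pattern c → ℝ) :=
  closure (⋃ k ∈ {k : ℕ | 1 ≤ k}, jointTypesOfSide c k)

/-- The type `γ_i` of the first field. -/
def fstType {c : ℝ≥0} (q : Pattern c × Pattern c → ℝ) (a : Pattern c) : ℝ := ∑ b, q (a, b)

/-- The type `γ_j` of the second field. -/
def sndType {c : ℝ≥0} (q : Pattern c × Pattern c → ℝ) (b : Pattern c) : ℝ := ∑ a, q (a, b)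

/-- `γ_(u)`: the fraction of positions with value `u`. -/
def bitFreq {c : ℝ≥0} (γ : Pattern c → ℝ) (u : Fin 2) : ℝ :=
  ∑ a : Pattern c, if a (center c) = u then γ a else 0

/-- `λ_(u)(v)`: the fraction of positions where the first field has value `u` and the second has
value `v`. -/
def jointBitFreq {c : ℝ≥0} (q : Pattern c × Pattern c → ℝ) (u v : Fin 2) : ℝ :=
  ∑ a : Pattern c, ∑ b : Pattern c, if a (center c) = u ∧ b (center c) = v then q (a, b) else 0

/-- Joint types with `λ_(0)(1) + λ_(1)(0) ≥ D` and `γ_i(0) = γ_i(1) = 1/2`. -/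
def feasibleTypes (c : ℝ≥0) (D : ℝ) : Set (Pattern c × Pattern c → ℝ) :=
  {q | q ∈ jointTypes c ∧ D ≤ jointBitFreq q 0 1 + jointBitFreq q 1 0 ∧
    bitFreq (fstType q) 0 = 1 / 2 ∧ bitFreq (fstType q) 1 = 1 / 2}

/-! ### Information quantities (base 2) and the bound -/

/-- Entropy in bits. -/
def entropyBits {ι : Type*} [Fintype ι] (p : ι → ℝ) : ℝ :=
  ∑ x, -(p x * Real.logb 2 (p x))

open scoped Classical in
/-- Kullback-Leibler distance in bits of two probability mass functions on a finite set; it is `∞`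
unless `p` is absolutely continuous with respect to `q`. -/
def klBits {ι : Type*} [Fintype ι] (p q : ι → ℝ) : ℝ≥0∞ :=
  if ∀ x, q x = 0 → p x = 0 then ENNReal.ofReal (∑ x, p x * Real.logb 2 (p x / q x)) else ∞

section Bound

variable {𝒳 𝒴 : Type*} [Fintype 𝒳] [DecidableEq 𝒳] [Fintype 𝒴] {c : ℝ≥0}

/-- `P^γ(x)`: the law of the ideal output of a uniformly located sensor in a field of type `γ`. -/
def idealDist (Ψ : Pattern c → 𝒳) (γ : Pattern c → ℝ) (x : 𝒳) : ℝ :=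
  ∑ a, if Ψ a = x then γ a else 0

/-- `P^λ(x, x')`: the joint law of the ideal outputs of a uniformly located sensor in two fields of
joint type `λ`. -/
def idealJointDist (Ψ : Pattern c → 𝒳) (q : Pattern c × Pattern c → ℝ) (x x' : 𝒳) : ℝ :=
  ∑ a, ∑ b, if Ψ a = x ∧ Ψ b = x' then q (a, b) else 0

/-- `P^γ_{X_i Y}(x, y) = P^γ(x) P(y|x)`. -/
def distP (Ψ : Pattern c → 𝒳) (W : 𝒳 → PMF 𝒴) (γ : Pattern c → ℝ) (z : 𝒳 × 𝒴) : ℝ :=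
  idealDist Ψ γ z.1 * (W z.1 z.2).toReal

/-- `Q^λ_{X_i Y}(x, y) = ∑_{x'} P^λ(x, x') P(y|x')`. -/
def distQ (Ψ : Pattern c → 𝒳) (W : 𝒳 → PMF 𝒴) (q : Pattern c × Pattern c → ℝ) (z : 𝒳 × 𝒴) : ℝ :=
  ∑ x', idealJointDist Ψ q z.1 x' * (W x' z.2).toReal

/-- `D(P^{γ_i}_{X_i Y} ‖ Q^λ_{X_i Y}) / H((γ_j(0), γ_j(1)))`, in `[0, ∞]`. When the entropy is zero
this is `∞` for a nonzero numerator and `0` for a zero numerator. -/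
def boundRatio (Ψ : Pattern c → 𝒳) (W : 𝒳 → PMF 𝒴) (q : Pattern c × Pattern c → ℝ) : ℝ≥0∞ :=
  klBits (distP Ψ W (fstType q)) (distQ Ψ W q) / ENNReal.ofReal (entropyBits (bitFreq (sndType q)))

end Bound

end SensorField

end

/-!
The detectors decide by maximum likelihood, and the error probability is averaged over the uniformly
random networks. Fix the true field `f` and a joint type `q` with too large a distortion, let
`H = H(γ_j)`, and let `F(ρ)` be the Chernoff sum of `P^{γ_i}_{X_i Y}` and `Q^q_{X_i Y}`, that is
`∑ P^(1 - ρ) Q^ρ`. There are at most `2 ^ (k² H)` fields which have the joint type `q` with `f`. For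
given ideal and noisy outputs of the `n` sensors, with probabilities `Pⁿ` and `Qⁿ` under the product
distributions, the probability of seeing them while one of these fields is at least as likely as `f`
is at most `Pⁿ` (trivially) and at most `2 ^ (k² H) Qⁿ` (the union bound), hence for `0 < ρ < 1` at
most `(Pⁿ)^(1 - ρ) (2 ^ (k² H) Qⁿ)^ρ`. Summing over the outputs gives Gallager's bound
`(2 ^ (ρ R H) F(ρ)) ^ n`.

The Kullback-Leibler distance is the supremum of the Rényi divergences `-ρ⁻¹ log₂ F(ρ)`, so
`R < D(P ‖ Q) / H` if and only if the base of Gallager's bound is less than `1` for some `ρ`. The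
bases are continuous in `q`. This shows that the ratio is lower semicontinuous, hence attains its
minimum, and by compactness it makes the exponent uniform over all joint types which are balanced up
to some `δ`. There are only polynomially many joint types, and by Chebyshev's inequality the fields
which are not balanced up to `δ` are a vanishing fraction of all fields.
-/

namespace SensorField

open Finset

section Divergence

variable {ι : Type*} [Fintype ι] {ρ r : ℝ} {p q : ι → ℝ}

/-- The Chernoff sum of two probability mass functions: `2 ^ (-ρ D)`, where `D` is their Rényi
divergence of order `1 - ρ`. It measures how hard it is to tell `p` from `q`. -/
noncomputable def chernoffSum (ρ : ℝ) (p q : ι → ℝ) : ℝ :=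
  ∑ x, p x ^ (1 - ρ) * q x ^ ρ

theorem chernoffSum_nonneg (hp : ∀ x, 0 ≤ p x) (hq : ∀ x, 0 ≤ q x) : 0 ≤ chernoffSum ρ p q :=
  sum_nonneg fun x _ => mul_nonneg (Real.rpow_nonneg (hp x) _) (Real.rpow_nonneg (hq x) _)

theorem chernoffSum_const_mul (hp : ∀ x, 0 ≤ p x) (hq : ∀ x, 0 ≤ q x) {a : ℝ} (ha : 0 ≤ a) :
    chernoffSum ρ (fun x => a * p x) (fun x => a * q x) = a * chernoffSum ρ p q := by
  have hsplit : a ^ (1 - ρ) * a ^ ρ = a := by rw [← Real.rpow_add' ha (by simp)]; simp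
  rw [chernoffSum, chernoffSum, mul_sum]
  refine sum_congr rfl fun x _ => ?_
  rw [Real.mul_rpow ha (hp x), Real.mul_rpow ha (hq x), mul_mul_mul_comm, hsplit]

theorem mul_two_rpow_neg_mul_logb_div {a b : ℝ} (ha : 0 ≤ a) (hb : 0 ≤ b) (hab : b = 0 → a = 0)
    (hρ : ρ < 1) : a * 2 ^ (-(ρ * Real.logb 2 (a / b))) = a ^ (1 - ρ) * b ^ ρ := by
  rcases ha.eq_or_lt with rfl | ha
  · rw [Real.zero_rpow (sub_ne_zero.2 hρ.ne'), zero_mul, zero_mul]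
  have hb : 0 < b := hb.lt_of_ne fun h => ha.ne' (hab h.symm)
  rw [← mul_neg_one, mul_right_comm, mul_comm, mul_comm _ (Real.logb _ _), Real.rpow_mul two_pos.le,
    Real.rpow_logb two_pos one_lt_two.ne' (div_pos ha hb), mul_neg_one,
    Real.rpow_neg (by positivity), Real.div_rpow ha.le hb.le, Real.rpow_sub ha, Real.rpow_one]
  field_simp

/-- Jensen's inequality for `x ↦ 2 ^ x`. -/
theorem two_rpow_neg_mul_le_chernoffSum (hp : ∀ x, 0 ≤ p x) (hq : ∀ x, 0 ≤ q x)
    (hac : ∀ x, q x = 0 → p x = 0) (hsum : ∑ x, p x = 1) (hρ : ρ < 1) :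
    2 ^ (-(ρ * ∑ x, p x * Real.logb 2 (p x / q x))) ≤ chernoffSum ρ p q := by
  calc (2 : ℝ) ^ (-(ρ * ∑ x, p x * Real.logb 2 (p x / q x)))
      = 2 ^ (∑ x, p x • -(ρ * Real.logb 2 (p x / q x))) := by
        simp only [smul_eq_mul, mul_neg, sum_neg_distrib, mul_sum, mul_left_comm]
    _ ≤ ∑ x, p x • 2 ^ (-(ρ * Real.logb 2 (p x / q x))) :=
        (convexOn_rpow_left two_pos).map_sum_le (fun x _ => hp x) hsum fun _ _ => Set.mem_univ _
    _ = chernoffSum ρ p q :=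
        sum_congr rfl fun x _ => mul_two_rpow_neg_mul_logb_div (hp x) (hq x) (hac x) hρ

/-- As a function of `ρ`, the left-hand side has the value `1` and the derivative
`(r - D(p ‖ q)) log 2` at `0`. -/
theorem eventually_two_rpow_mul_chernoffSum_lt_one (hp : ∀ x, 0 ≤ p x) (hq : ∀ x, 0 ≤ q x)
    (hac : ∀ x, q x = 0 → p x = 0) (hsum : ∑ x, p x = 1)
    (hr : r < ∑ x, p x * Real.logb 2 (p x / q x)) :
    ∀ᶠ ρ : ℝ in 𝓝[>] 0, 2 ^ (ρ * r) * chernoffSum ρ p q < 1 := by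
  set L : ι → ℝ := fun x => Real.logb 2 (p x / q x)
  set F : ℝ → ℝ := fun ρ => ∑ x, p x * 2 ^ (ρ * (r - L x))
  have hF_zero : F 0 = 1 := by simp [F, hsum]
  have hF_deriv : HasDerivAt F (∑ x, p x * (Real.log 2 * (r - L x))) 0 := by
    refine .fun_sum fun x _ => .const_mul _ ?_
    simpa using ((hasDerivAt_id (0 : ℝ)).mul_const (r - L x)).const_rpow two_pos
  have hderiv_neg : ∑ x, p x * (Real.log 2 * (r - L x)) < 0 := by
    have : ∑ x, p x * (Real.log 2 * (r - L x)) = Real.log 2 * (r - ∑ x, p x * L x) := by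
      rw [mul_sub, mul_sum, ← mul_one (Real.log 2 * r), ← hsum, mul_sum, ← sum_sub_distrib]
      exact sum_congr rfl fun x _ => by ring
    rw [this]
    exact mul_neg_of_pos_of_neg (Real.log_pos one_lt_two) (sub_neg.2 hr)
  filter_upwards [hF_deriv.tendsto_slope_zero_right.eventually_lt_const hderiv_neg,
    Ioo_mem_nhdsGT (one_pos : (0 : ℝ) < 1)] with ρ hslope hρ
  have hF_eq : F ρ = 2 ^ (ρ * r) * chernoffSum ρ p q := by
    rw [chernoffSum, mul_sum]
    refine sum_congr rfl fun x _ => ?_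
    rw [← mul_two_rpow_neg_mul_logb_div (hp x) (hq x) (hac x) hρ.2, mul_left_comm,
      ← Real.rpow_add two_pos, ← sub_eq_add_neg, ← mul_sub]
  rw [zero_add, hF_zero, smul_eq_mul, inv_mul_eq_div, div_neg_iff] at hslope
  have := hρ.1
  rw [← hF_eq]
  rcases hslope with h | h <;> linarith

/-- If `p` charges a zero of `q`, the Chernoff sum tends to `p {q ≠ 0} < 1` as `ρ → 0`. -/
theorem eventually_two_rpow_mul_chernoffSum_lt_one_of_not_ac (hp : ∀ x, 0 ≤ p x)
    (hac : ¬ ∀ x, q x = 0 → p x = 0) (hsum : ∑ x, p x = 1) (r : ℝ) :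
    ∀ᶠ ρ : ℝ in 𝓝[>] 0, 2 ^ (ρ * r) * chernoffSum ρ p q < 1 := by
  classical
  push Not at hac
  obtain ⟨x₀, hqx₀, hpx₀⟩ := hac
  have hmass : ∑ x with q x ≠ 0, p x < 1 := by
    rw [← hsum]
    exact sum_lt_sum_of_subset (filter_subset _ _) (mem_univ x₀) (by simp [hqx₀])
      ((hp x₀).lt_of_ne' hpx₀) fun x _ _ => hp x
  have hcont : ContinuousAt
      (fun ρ : ℝ => 2 ^ (ρ * r) * ∑ x with q x ≠ 0, p x ^ (1 - ρ) * q x ^ ρ) 0 := by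
    refine .mul (.rpow (by fun_prop) (by fun_prop) (.inl two_ne_zero))
      (tendsto_finsetSum _ fun x hx => .mul ?_ ?_)
    · exact ContinuousAt.rpow (by fun_prop) (by fun_prop) (.inr (by simp))
    · exact Real.continuousAt_const_rpow (mem_filter.1 hx).2
  have hlim := hcont.tendsto.eventually_lt_const (u := 1) (by simpa using hmass)
  filter_upwards [nhdsWithin_le_nhds hlim, self_mem_nhdsWithin] with ρ hlt hρ
  rw [sum_filter_of_ne] at hlt
  · exact hlt
  · rintro x - hne hqx
    exact hne (by rw [hqx, Real.zero_rpow (ne_of_gt hρ), mul_zero])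

/-- The Kullback-Leibler distance is the supremum of the Rényi divergences of order less
than `1`. -/
theorem ofReal_lt_klBits_iff (hp : ∀ x, 0 ≤ p x) (hq : ∀ x, 0 ≤ q x) (hsum : ∑ x, p x = 1)
    (hr : 0 ≤ r) :
    ENNReal.ofReal r < klBits p q ↔
      ∃ ρ ∈ Set.Ioo (0 : ℝ) 1, 2 ^ (ρ * r) * chernoffSum ρ p q < 1 := by
  have hIoo : ∀ᶠ ρ : ℝ in 𝓝[>] 0, ρ ∈ Set.Ioo (0 : ℝ) 1 := Ioo_mem_nhdsGT one_pos
  unfold klBits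
  split_ifs with hac
  · rw [ENNReal.ofReal_lt_ofReal_iff_of_nonneg hr]
    constructor
    · intro h
      exact (hIoo.and (eventually_two_rpow_mul_chernoffSum_lt_one hp hq hac hsum h)).exists
    · rintro ⟨ρ, hρ, hlt⟩
      have hlt := (mul_le_mul_of_nonneg_left (two_rpow_neg_mul_le_chernoffSum hp hq hac hsum hρ.2)
        (by positivity)).trans_lt hlt
      rw [← Real.rpow_add two_pos, ← sub_eq_add_neg, ← mul_sub,
        Real.rpow_lt_one_iff_of_pos two_pos] at hlt
      rcases hlt with h | h
      · exact sub_neg.1 (neg_of_mul_neg_right h.2 hρ.1.le)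
      · exact absurd h.1 (by norm_num)
  · exact iff_of_true ENNReal.ofReal_lt_top
      (hIoo.and (eventually_two_rpow_mul_chernoffSum_lt_one_of_not_ac hp hac hsum r)).exists

theorem entropyBits_nonneg (hp : ∀ x, 0 ≤ p x) (hsum : ∑ x, p x = 1) : 0 ≤ entropyBits p := by
  refine sum_nonneg fun x _ => neg_nonneg.2 ?_
  have hpx : p x ≤ 1 := hsum ▸ single_le_sum (fun y _ => hp y) (mem_univ x)
  exact mul_nonpos_of_nonneg_of_nonpos (hp x) (Real.logb_nonpos one_lt_two (hp x) hpx)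

theorem continuous_entropyBits : Continuous (entropyBits : (ι → ℝ) → ℝ) := by
  unfold entropyBits Real.logb
  simp only [← mul_div_assoc]
  have := Real.continuous_mul_log
  fun_prop

end Divergence

section Types

variable {c : ℝ≥0} {k : ℕ} {𝒳 𝒴 : Type*} {q : Pattern c × Pattern c → ℝ}

theorem wrap_zero (x : Fin k) : wrap x 0 = x := by
  ext
  simp only [wrap, add_zero]
  rw [Int.emod_eq_of_lt (by positivity) (by exact_mod_cast x.2), Int.toNat_natCast]

theorem patternAt_center (f : Field k) (h : Fin k × Fin k) : patternAt c f h (center c) = f h := by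
  simp [patternAt, center, wrap_zero]

theorem jointType_nonneg (f f' : Field k) (p : Pattern c × Pattern c) :
    0 ≤ jointType c f f' p := by
  unfold jointType
  positivity

theorem sum_jointType_mul (f f' : Field k) (φ : Pattern c × Pattern c → ℝ) :
    ∑ p, jointType c f f' p * φ p =
      (∑ h, φ (patternAt c f h, patternAt c f' h)) / (k : ℝ) ^ 2 := by
  rw [← sum_fiberwise univ (fun h => (patternAt c f h, patternAt c f' h)), sum_div]
  refine sum_congr rfl fun p _ => ?_
  rw [sum_congr rfl (g := fun _ => φ p) fun h hh => by rw [(mem_filter.1 hh).2], sum_const,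
    nsmul_eq_mul, jointType, div_mul_eq_mul_div]
  simp only [Prod.ext_iff]

theorem sq_mul_sum_jointType_mul (hk : k ≠ 0) (f f' : Field k) (φ : Pattern c × Pattern c → ℝ) :
    (k : ℝ) ^ 2 * ∑ p, jointType c f f' p * φ p =
      ∑ h, φ (patternAt c f h, patternAt c f' h) := by
  rw [sum_jointType_mul, mul_div_cancel₀ _ (by positivity)]

theorem sum_jointType (hk : k ≠ 0) (f f' : Field k) : ∑ p, jointType c f f' p = 1 := by
  have h := sum_jointType_mul (c := c) f f' 1
  simpa [← sq, hk] using h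

theorem jointType_mem_stdSimplex (hk : k ≠ 0) (f f' : Field k) :
    jointType c f f' ∈ stdSimplex ℝ (Pattern c × Pattern c) :=
  ⟨jointType_nonneg f f', sum_jointType hk f f'⟩

theorem jointType_mem_jointTypes (hk : k ≠ 0) (f f' : Field k) :
    jointType c f f' ∈ jointTypes c :=
  subset_closure (Set.mem_biUnion (Nat.one_le_iff_ne_zero.2 hk) ⟨f, f', rfl⟩)

theorem jointTypes_subset_stdSimplex : jointTypes c ⊆ stdSimplex ℝ (Pattern c × Pattern c) := by
  refine closure_minimal (Set.iUnion₂_subset fun k hk => ?_) (isClosed_stdSimplex ℝ _)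
  rintro _ ⟨f, f', rfl⟩
  exact jointType_mem_stdSimplex (Nat.one_le_iff_ne_zero.1 hk) f f'

theorem isCompact_jointTypes : IsCompact (jointTypes c) :=
  (isCompact_stdSimplex ℝ _).of_isClosed_subset isClosed_closure jointTypes_subset_stdSimplex

theorem bitFreq_nonneg {γ : Pattern c → ℝ} (hγ : ∀ a, 0 ≤ γ a) (u : Fin 2) : 0 ≤ bitFreq γ u :=
  sum_nonneg fun a _ => by split_ifs <;> simp [hγ a]

theorem sum_bitFreq (γ : Pattern c → ℝ) : ∑ u, bitFreq γ u = ∑ a, γ a := by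
  unfold bitFreq
  rw [sum_comm]
  simp

theorem sndType_nonneg (hq : ∀ p, 0 ≤ q p) (b : Pattern c) : 0 ≤ sndType q b :=
  sum_nonneg fun _ _ => hq _

theorem sum_fstType (q : Pattern c × Pattern c → ℝ) : ∑ a, fstType q a = ∑ p, q p :=
  (Fintype.sum_prod_type _).symm

theorem sum_sndType (q : Pattern c × Pattern c → ℝ) : ∑ b, sndType q b = ∑ p, q p :=
  (Fintype.sum_prod_type_right _).symm

theorem bitFreq_fstType_eq_sum_mul (q : Pattern c × Pattern c → ℝ) (u : Fin 2) :
    bitFreq (fstType q) u = ∑ p, q p * if p.1 (center c) = u then 1 else 0 := by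
  unfold bitFreq fstType
  rw [Fintype.sum_prod_type]
  exact sum_congr rfl fun a _ => by split_ifs <;> simp

theorem bitFreq_sndType_eq_sum_mul (q : Pattern c × Pattern c → ℝ) (u : Fin 2) :
    bitFreq (sndType q) u = ∑ p, q p * if p.2 (center c) = u then 1 else 0 := by
  unfold bitFreq sndType
  rw [Fintype.sum_prod_type_right]
  exact sum_congr rfl fun b _ => by split_ifs <;> simp

theorem jointBitFreq_eq_sum_mul (q : Pattern c × Pattern c → ℝ) (u v : Fin 2) :
    jointBitFreq q u v =
      ∑ p, q p * if p.1 (center c) = u ∧ p.2 (center c) = v then 1 else 0 := by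
  unfold jointBitFreq
  rw [Fintype.sum_prod_type]
  exact sum_congr rfl fun a _ => sum_congr rfl fun b _ => by split_ifs <;> simp

theorem continuous_bitFreq_fstType (u : Fin 2) :
    Continuous fun q : Pattern c × Pattern c → ℝ => bitFreq (fstType q) u := by
  simp only [bitFreq_fstType_eq_sum_mul]
  fun_prop

theorem continuous_bitFreq_sndType (u : Fin 2) :
    Continuous fun q : Pattern c × Pattern c → ℝ => bitFreq (sndType q) u := by
  simp only [bitFreq_sndType_eq_sum_mul]
  fun_prop

theorem continuous_jointBitFreq (u v : Fin 2) :
    Continuous fun q : Pattern c × Pattern c → ℝ => jointBitFreq q u v := by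
  simp only [jointBitFreq_eq_sum_mul]
  fun_prop

theorem bitFreq_fstType_jointType (f f' : Field k) (u : Fin 2) :
    bitFreq (fstType (jointType c f f')) u = (#{h | f h = u} : ℝ) / (k : ℝ) ^ 2 := by
  rw [bitFreq_fstType_eq_sum_mul, sum_jointType_mul]
  simp only [patternAt_center, sum_boole]

theorem bitFreq_sndType_jointType (f f' : Field k) (u : Fin 2) :
    bitFreq (sndType (jointType c f f')) u = (#{h | f' h = u} : ℝ) / (k : ℝ) ^ 2 := by
  rw [bitFreq_sndType_eq_sum_mul, sum_jointType_mul]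
  simp only [patternAt_center, sum_boole]

theorem jointBitFreq_jointType (f f' : Field k) :
    jointBitFreq (jointType c f f') 0 1 + jointBitFreq (jointType c f f') 1 0 =
      (hammingDist f f' : ℝ) / (k : ℝ) ^ 2 := by
  have hbit : ∀ a b : Fin 2, (if a = 0 ∧ b = 1 then (1 : ℝ) else 0) +
      (if a = 1 ∧ b = 0 then 1 else 0) = if a ≠ b then 1 else 0 := by
    intro a b
    fin_cases a <;> fin_cases b <;> simp
  simp only [jointBitFreq_eq_sum_mul, sum_jointType_mul, patternAt_center]
  rw [← add_div, ← sum_add_distrib, hammingDist, ← sum_boole]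
  simp only [hbit]

theorem feasibleTypes_nonempty (c : ℝ≥0) {D : ℝ} (hD : D ≤ 1) : (feasibleTypes c D).Nonempty := by
  refine ⟨jointType c (k := 2) (fun h => h.1) (fun h => 1 - h.1),
    jointType_mem_jointTypes two_ne_zero _ _, ?_, ?_, ?_⟩
  · have : hammingDist (fun h : Fin 2 × Fin 2 => h.1) (fun h => 1 - h.1) = 4 := by decide
    rw [jointBitFreq_jointType, this]
    norm_num [hD]
  · have : #{h : Fin 2 × Fin 2 | h.1 = 0} = 2 := by decide
    rw [bitFreq_fstType_jointType, this]
    norm_num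
  · have : #{h : Fin 2 × Fin 2 | h.1 = 1} = 2 := by decide
    rw [bitFreq_fstType_jointType, this]
    norm_num

theorem isCompact_feasibleTypes (c : ℝ≥0) (D : ℝ) : IsCompact (feasibleTypes c D) :=
  isCompact_jointTypes.inter_right
    ((isClosed_le continuous_const
      ((continuous_jointBitFreq 0 1).add (continuous_jointBitFreq 1 0))).inter
    ((isClosed_eq (continuous_bitFreq_fstType 0) continuous_const).inter
      (isClosed_eq (continuous_bitFreq_fstType 1) continuous_const)))

theorem sum_toReal_pmf_apply {α : Type*} [Fintype α] (p : PMF α) : ∑ y, (p y).toReal = 1 := by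
  rw [← ENNReal.toReal_sum fun y _ => p.apply_ne_top y, ← tsum_fintype (L := .unconditional α),
    p.tsum_coe, ENNReal.toReal_one]

variable [DecidableEq 𝒳] (Ψ : Pattern c → 𝒳) (W : 𝒳 → PMF 𝒴)

theorem distP_fstType_eq_sum_mul (q : Pattern c × Pattern c → ℝ) (z : 𝒳 × 𝒴) :
    distP Ψ W (fstType q) z = ∑ p, q p * if Ψ p.1 = z.1 then (W z.1 z.2).toReal else 0 := by
  unfold distP idealDist fstType
  rw [Fintype.sum_prod_type, sum_mul]
  exact sum_congr rfl fun a _ => by split_ifs <;> simp [sum_mul]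

theorem distP_nonneg (hq : ∀ p, 0 ≤ q p) (z : 𝒳 × 𝒴) : 0 ≤ distP Ψ W (fstType q) z := by
  rw [distP_fstType_eq_sum_mul]
  exact sum_nonneg fun p _ => mul_nonneg (hq p) (by split_ifs <;> simp)

theorem sum_distP [Fintype 𝒳] [Fintype 𝒴] (q : Pattern c × Pattern c → ℝ) :
    ∑ z, distP Ψ W (fstType q) z = ∑ p, q p := by
  rw [← sum_fstType, Fintype.sum_prod_type]
  simp only [distP, ← mul_sum, sum_toReal_pmf_apply, mul_one]
  unfold idealDist
  rw [sum_comm]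
  simp

variable [Fintype 𝒳]

theorem distQ_eq_sum_mul (q : Pattern c × Pattern c → ℝ) (z : 𝒳 × 𝒴) :
    distQ Ψ W q z = ∑ p, q p * if Ψ p.1 = z.1 then (W (Ψ p.2) z.2).toReal else 0 := by
  unfold distQ idealJointDist
  simp only [Fintype.sum_prod_type, sum_mul]
  rw [sum_comm]
  refine sum_congr rfl fun a _ => ?_
  rw [sum_comm]
  refine sum_congr rfl fun b _ => ?_
  by_cases h : Ψ a = z.1 <;> simp [h]

theorem distQ_nonneg (hq : ∀ p, 0 ≤ q p) (z : 𝒳 × 𝒴) : 0 ≤ distQ Ψ W q z := by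
  rw [distQ_eq_sum_mul]
  exact sum_nonneg fun p _ => mul_nonneg (hq p) (by split_ifs <;> simp)

theorem entropyBits_bitFreq_sndType_nonneg (hq : q ∈ stdSimplex ℝ (Pattern c × Pattern c)) :
    0 ≤ entropyBits (bitFreq (sndType q)) :=
  entropyBits_nonneg (bitFreq_nonneg (sndType_nonneg hq.1))
    (by rw [sum_bitFreq, sum_sndType, hq.2])

variable [Fintype 𝒴] {ρ R : ℝ}

/-- Gallager's bound, per sensor, on the probability that at rate `R` a field is confused with one
of the `2 ^ (k² H)` fields which have the joint type `q` with it. -/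
noncomputable def gallagerFactor (ρ R : ℝ) (q : Pattern c × Pattern c → ℝ) : ℝ :=
  2 ^ (ρ * (R * entropyBits (bitFreq (sndType q)))) *
    chernoffSum ρ (distP Ψ W (fstType q)) (distQ Ψ W q)

theorem gallagerFactor_nonneg (hq : ∀ p, 0 ≤ q p) : 0 ≤ gallagerFactor Ψ W ρ R q :=
  mul_nonneg (by positivity) (chernoffSum_nonneg (distP_nonneg Ψ W hq) (distQ_nonneg Ψ W hq))

theorem continuous_gallagerFactor (hρ : ρ ∈ Set.Ioo 0 1) :
    Continuous (gallagerFactor Ψ W ρ R) := by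
  unfold gallagerFactor chernoffSum
  simp only [distP_fstType_eq_sum_mul, distQ_eq_sum_mul]
  have hentropy : Continuous fun q : Pattern c × Pattern c → ℝ =>
      entropyBits (bitFreq (sndType q)) :=
    continuous_entropyBits.comp (continuous_pi continuous_bitFreq_sndType)
  refine .mul (continuous_const.rpow (by fun_prop) fun _ => .inl two_ne_zero)
    (continuous_finsetSum _ fun z _ => .mul ?_ ?_)
  · exact Continuous.rpow_const (by fun_prop) fun _ => .inr (sub_pos.2 hρ.2).le
  · exact Continuous.rpow_const (by fun_prop) fun _ => .inr hρ.1.le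

theorem ofReal_lt_boundRatio_iff (hq : q ∈ stdSimplex ℝ (Pattern c × Pattern c)) (hR : 0 ≤ R) :
    ENNReal.ofReal R < boundRatio Ψ W q ↔ ∃ ρ ∈ Set.Ioo 0 1, gallagerFactor Ψ W ρ R q < 1 := by
  have hH := entropyBits_bitFreq_sndType_nonneg hq
  rw [boundRatio,
    ENNReal.lt_div_iff_mul_lt (.inr ENNReal.ofReal_ne_top) (.inl ENNReal.ofReal_ne_top),
    ← ENNReal.ofReal_mul hR, ofReal_lt_klBits_iff (distP_nonneg Ψ W hq.1) (distQ_nonneg Ψ W hq.1)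
      (by rw [sum_distP, hq.2]) (mul_nonneg hR hH)]
  rfl

theorem lowerSemicontinuousOn_boundRatio :
    LowerSemicontinuousOn (boundRatio Ψ W) (jointTypes c) := by
  intro q₀ hq₀ a ha
  lift a to ℝ≥0 using ha.ne_top
  rw [← ENNReal.ofReal_coe_nnreal] at ha ⊢
  obtain ⟨ρ, hρ, hlt⟩ := (ofReal_lt_boundRatio_iff Ψ W (jointTypes_subset_stdSimplex hq₀) a.2).1 ha
  filter_upwards [self_mem_nhdsWithin, nhdsWithin_le_nhds
    ((continuous_gallagerFactor Ψ W hρ).continuousAt.eventually_lt_const hlt)] with q hq hlt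
  exact (ofReal_lt_boundRatio_iff Ψ W (jointTypes_subset_stdSimplex hq) a.2).2 ⟨ρ, hρ, hlt⟩

theorem exists_isLeast_boundRatio {D : ℝ} (hD : D ≤ 1) :
    ∃ m, IsLeast (boundRatio Ψ W '' feasibleTypes c D) m := by
  obtain ⟨q, hq, hmin⟩ := LowerSemicontinuousOn.exists_isMinOn (feasibleTypes_nonempty c hD)
    (isCompact_feasibleTypes c D) ((lowerSemicontinuousOn_boundRatio Ψ W).mono fun q hq => hq.1)
  exact ⟨_, ⟨q, hq, rfl⟩, Set.forall_mem_image.2 hmin⟩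

end Types

section Words

variable {ι α : Type*} [Fintype ι] [Fintype α]

/-- Each of these words has probability `2 ^ (-N H(p))` under the product measure with marginals
`p`, where `N` is its length. -/
theorem card_le_two_rpow_entropyBits [DecidableEq α] {p : α → ℝ} (hp : ∀ u, 0 ≤ p u)
    (hsum : ∑ u, p u = 1) (J : Finset (ι → α))
    (hJ : ∀ f ∈ J, ∀ u, (#{h | f h = u} : ℝ) = Fintype.card ι * p u) :
    (#J : ℝ) ≤ 2 ^ (Fintype.card ι * entropyBits p) := by
  classical
  have hword : ∀ f ∈ J, ∏ h, p (f h) = 2 ^ (-(Fintype.card ι * entropyBits p)) := by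
    intro f hf
    rw [entropyBits, sum_neg_distrib, mul_neg, neg_neg, mul_sum, Real.rpow_sum_of_pos two_pos,
      ← prod_fiberwise' univ f]
    refine prod_congr rfl fun u _ => ?_
    rw [prod_const, ← mul_assoc, ← hJ f hf u]
    rcases (hp u).eq_or_lt with hpu | hpu
    · have hcount := hJ f hf u
      rw [← hpu, mul_zero, Nat.cast_eq_zero] at hcount
      simp [hcount]
    · rw [mul_comm, Real.rpow_mul_natCast two_pos.le, Real.rpow_logb two_pos one_lt_two.ne' hpu]
  have htotal : ∑ f ∈ J, ∏ h, p (f h) ≤ 1 := by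
    calc ∑ f ∈ J, ∏ h, p (f h) ≤ ∑ f : ι → α, ∏ h, p (f h) :=
          sum_le_univ_sum_of_nonneg fun f => prod_nonneg fun h _ => hp _
      _ = 1 := by rw [← Fintype.prod_sum, hsum, prod_const_one]
  rwa [sum_congr rfl hword, sum_const, nsmul_eq_mul, Real.rpow_neg two_pos.le,
    ← div_eq_mul_inv, div_le_one (by positivity)] at htotal

theorem sum_apply_mul_apply_eq_zero [DecidableEq ι] {σ : α → ℝ} (hσ : ∑ u, σ u = 0)
    (τ : α → ℝ) {h h' : ι} (hne : h' ≠ h) : ∑ f : ι → α, σ (f h) * τ (f h') = 0 := by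
  rw [← (Equiv.funSplitAt h α).symm.sum_comp, Fintype.sum_prod_type_right]
  simp [hne, ← sum_mul, hσ]

/-- Bienaymé's identity. -/
theorem sum_sq_sum_apply [DecidableEq ι] {σ : α → ℝ} (hσ : ∑ u, σ u = 0) :
    ∑ f : ι → α, (∑ h, σ (f h)) ^ 2 = ∑ h, ∑ f : ι → α, σ (f h) ^ 2 := by
  simp only [sq, sum_mul_sum]
  rw [sum_comm]
  refine sum_congr rfl fun h _ => ?_
  rw [sum_comm]
  exact Fintype.sum_eq_single h fun h' hne => sum_apply_mul_apply_eq_zero hσ σ hne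

theorem card_unbalanced_le [DecidableEq ι] [Nonempty ι] {δ : ℝ} (hδ : 0 < δ) :
    (#{f : ι → Fin 2 | δ < |(#{h | f h = 0} : ℝ) / Fintype.card ι - 1 / 2|} : ℝ) ≤
      1 / (4 * δ ^ 2 * Fintype.card ι) * Fintype.card (ι → Fin 2) := by
  set N : ℝ := ((Fintype.card ι : ℕ) : ℝ)
  have hN : 0 < N := Nat.cast_pos.2 Fintype.card_pos
  set σ : Fin 2 → ℝ := fun u => (if u = 0 then 1 else 0) - 1 / 2
  have hσ : ∑ u, σ u = 0 := by norm_num [σ, Fin.sum_univ_two]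
  have hσ_sq : ∀ u, σ u ^ 2 = 1 / 4 := by
    intro u
    simp only [σ]
    split_ifs <;> norm_num
  have hcount (f : ι → Fin 2) : ∑ h, σ (f h) = N * ((#{h | f h = 0} : ℝ) / N - 1 / 2) := by
    rw [sum_sub_distrib, sum_boole, sum_const, nsmul_eq_mul, card_univ, mul_sub,
      mul_div_cancel₀ _ hN.ne']
  have chebyshev : #{f : ι → Fin 2 | δ < |(#{h | f h = 0} : ℝ) / N - 1 / 2|} • (N * δ) ^ 2 ≤
      N * (Fintype.card (ι → Fin 2) * (1 / 4)) := by
    calc _ ≤ ∑ f : ι → Fin 2 with δ < |(#{h | f h = 0} : ℝ) / N - 1 / 2|,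
          (∑ h, σ (f h)) ^ 2 := by
          refine card_nsmul_le_sum _ _ _ fun f hf => ?_
          rw [hcount, mul_pow, mul_pow, ← sq_abs (_ - _)]
          gcongr
          exact (mem_filter.1 hf).2.le
      _ ≤ ∑ f : ι → Fin 2, (∑ h, σ (f h)) ^ 2 := sum_le_univ_sum_of_nonneg fun f => sq_nonneg _
      _ = _ := by
          simp only [sum_sq_sum_apply hσ, hσ_sq, sum_const, card_univ, nsmul_eq_mul, N]
  rw [nsmul_eq_mul, ← le_div_iff₀ (by positivity)] at chebyshev
  refine chebyshev.trans_eq ?_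
  field_simp

end Words

section RandomCoding

variable {S A B ι : Type*} [Fintype S] [DecidableEq A] {n : ℕ} {ρ : ℝ}

theorem le_rpow_mul_rpow {a b t : ℝ} (ht : 0 ≤ t) (ha : t ≤ a) (hb : t ≤ b)
    (hρ : ρ ∈ Set.Icc 0 1) : t ≤ a ^ (1 - ρ) * b ^ ρ := by
  have hρ' : 0 ≤ 1 - ρ := sub_nonneg.2 hρ.2
  calc t = t ^ (1 - ρ) * t ^ ρ := by
        rw [← Real.rpow_add_of_nonneg ht hρ' hρ.1, sub_add_cancel, Real.rpow_one]
    _ ≤ a ^ (1 - ρ) * b ^ ρ :=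
        mul_le_mul (Real.rpow_le_rpow ht ha hρ') (Real.rpow_le_rpow ht hb hρ.1)
          (Real.rpow_nonneg ht _) (Real.rpow_nonneg (ht.trans ha) _)

/-- The joint law of label and output of a sensor at a uniform position in `S`, up to the factor
`|S|`, where the position `h` has the label `x h` and emits `y` with probability `u h y`. -/
def outputMass (x : S → A) (u : S → B → ℝ) (z : A × B) : ℝ :=
  ∑ h with x h = z.1, u h z.2

variable {x : S → A} {u : S → B → ℝ} {v : ι → S → B → ℝ} {J : Finset ι} {Q : A × B → ℝ}

theorem outputMass_nonneg (hu : ∀ h y, 0 ≤ u h y) (z : A × B) : 0 ≤ outputMass x u z :=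
  sum_nonneg fun h _ => hu h z.2

theorem sum_prod_eq_prod_outputMass (x : S → A) (u : S → B → ℝ) (z : Fin n → A × B) :
    ∑ s : Fin n → S with ∀ l, x (s l) = (z l).1, ∏ l, u (s l) (z l).2 =
      ∏ l, outputMass x u (z l) := by
  classical
  unfold outputMass
  rw [prod_univ_sum]
  refine sum_congr ?_ fun _ _ => rfl
  ext s
  simp

/-- Interpolates between the trivial bound, by the probability of `z`, and the union bound. -/
theorem sum_prod_likelihood_exceeded_le (hu : ∀ h y, 0 ≤ u h y) (hv : ∀ j h y, 0 ≤ v j h y)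
    (hQ₀ : ∀ z, 0 ≤ Q z) (hQ : ∀ j ∈ J, outputMass x (v j) = Q) (hρ : ρ ∈ Set.Icc 0 1)
    (z : Fin n → A × B) (E : Finset (Fin n → S))
    (hE : ∀ s ∈ E, ∃ j ∈ J, ∏ l, u (s l) (z l).2 ≤ ∏ l, v j (s l) (z l).2) :
    ∑ s ∈ E with ∀ l, x (s l) = (z l).1, ∏ l, u (s l) (z l).2 ≤
      (#J : ℝ) ^ ρ * ∏ l, outputMass x u (z l) ^ (1 - ρ) * Q (z l) ^ ρ := by
  have hprod_u (s : Fin n → S) : 0 ≤ ∏ l, u (s l) (z l).2 := prod_nonneg fun _ _ => hu _ _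
  have hprod_v (j : ι) (s : Fin n → S) : 0 ≤ ∏ l, v j (s l) (z l).2 :=
    prod_nonneg fun _ _ => hv _ _ _
  have hsub : {s ∈ E | ∀ l, x (s l) = (z l).1} ⊆
      ({s | ∀ l, x (s l) = (z l).1} : Finset (Fin n → S)) := filter_subset_filter _ (subset_univ E)
  have htrivial : ∑ s ∈ E with ∀ l, x (s l) = (z l).1, ∏ l, u (s l) (z l).2 ≤
      ∏ l, outputMass x u (z l) := by
    rw [← sum_prod_eq_prod_outputMass]
    exact sum_le_sum_of_subset_of_nonneg hsub fun s _ _ => hprod_u s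
  have hunion : ∑ s ∈ E with ∀ l, x (s l) = (z l).1, ∏ l, u (s l) (z l).2 ≤
      #J * ∏ l, Q (z l) := by
    calc _ ≤ ∑ s ∈ E with ∀ l, x (s l) = (z l).1, ∑ j ∈ J, ∏ l, v j (s l) (z l).2 := by
          refine sum_le_sum fun s hs => ?_
          obtain ⟨j, hj, hle⟩ := hE s (mem_filter.1 hs).1
          exact hle.trans (single_le_sum (fun j _ => hprod_v j s) hj)
      _ ≤ ∑ s : Fin n → S with ∀ l, x (s l) = (z l).1, ∑ j ∈ J, ∏ l, v j (s l) (z l).2 :=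
          sum_le_sum_of_subset_of_nonneg hsub fun s _ _ => sum_nonneg fun j _ => hprod_v j s
      _ = #J * ∏ l, Q (z l) := by
          rw [sum_comm, sum_congr rfl fun j hj => by rw [sum_prod_eq_prod_outputMass, hQ j hj],
            sum_const, nsmul_eq_mul]
  refine (le_rpow_mul_rpow (sum_nonneg fun s _ => hprod_u s) htrivial hunion hρ).trans_eq ?_
  rw [Real.mul_rpow (Nat.cast_nonneg _) (prod_nonneg fun l _ => hQ₀ _), prod_mul_distrib,
    Real.finsetProd_rpow _ _ fun l _ => outputMass_nonneg hu _,
    Real.finsetProd_rpow _ _ fun l _ => hQ₀ _, mul_left_comm]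

/-- Random coding bound: `E y` consists of the choices of the positions for which, given the
outputs `y`, some alternative `j ∈ J` is at least as likely as the truth `u`. -/
theorem sum_likelihood_exceeded_le [Fintype A] [Fintype B] (hu : ∀ h y, 0 ≤ u h y)
    (hv : ∀ j h y, 0 ≤ v j h y) (hQ₀ : ∀ z, 0 ≤ Q z) (hQ : ∀ j ∈ J, outputMass x (v j) = Q)
    (hρ : ρ ∈ Set.Icc 0 1) (E : (Fin n → B) → Finset (Fin n → S))
    (hE : ∀ y, ∀ s ∈ E y, ∃ j ∈ J, ∏ l, u (s l) (y l) ≤ ∏ l, v j (s l) (y l)) :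
    ∑ y, ∑ s ∈ E y, ∏ l, u (s l) (y l) ≤
      (#J : ℝ) ^ ρ * chernoffSum ρ (outputMass x u) Q ^ n := by
  calc ∑ y, ∑ s ∈ E y, ∏ l, u (s l) (y l)
      = ∑ z : Fin n → A × B, ∑ s ∈ E (fun l => (z l).2) with ∀ l, x (s l) = (z l).1,
          ∏ l, u (s l) (z l).2 := by
        rw [← (Equiv.arrowProdEquivProdArrow (Fin n) (fun _ => A) fun _ => B).symm.sum_comp,
          Fintype.sum_prod_type_right]
        refine sum_congr rfl fun y _ => ?_
        rw [← sum_fiberwise (E y) fun s l => x (s l)]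
        simp only [funext_iff]
        rfl
    _ ≤ ∑ z : Fin n → A × B,
          (#J : ℝ) ^ ρ * ∏ l, outputMass x u (z l) ^ (1 - ρ) * Q (z l) ^ ρ :=
        sum_le_sum fun z _ => sum_prod_likelihood_exceeded_le hu hv hQ₀ hQ hρ z _ (hE _)
    _ = (#J : ℝ) ^ ρ * chernoffSum ρ (outputMass x u) Q ^ n := by
        rw [← mul_sum, chernoffSum, Fintype.sum_pow]

end RandomCoding

section MaximumLikelihood

variable {𝒳 𝒴 : Type*} {c : ℝ≥0} {k n : ℕ} (Ψ : Pattern c → 𝒳) (W : 𝒳 → PMF 𝒴)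

/-- The probability that a sensor at position `h` of the field `f` has the output `y`. -/
def sensorProb (f : Field k) (h : Fin k × Fin k) (y : 𝒴) : ℝ :=
  (W (Ψ (patternAt c f h)) y).toReal

theorem sensorProb_nonneg (f : Field k) (h : Fin k × Fin k) (y : 𝒴) : 0 ≤ sensorProb Ψ W f h y :=
  ENNReal.toReal_nonneg

theorem outputProb_nonneg (s : Network k n) (f : Field k) (y : Fin n → 𝒴) :
    0 ≤ outputProb Ψ W s f y :=
  prod_nonneg fun _ _ => ENNReal.toReal_nonneg

/-- `g` is a maximum likelihood detector of the network `s`, ties being broken arbitrarily. -/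
def IsMaximumLikelihood (s : Network k n) (g : (Fin n → 𝒴) → Field k) : Prop :=
  ∀ y f, outputProb Ψ W s f y ≤ outputProb Ψ W s (g y) y

theorem exists_isMaximumLikelihood (s : Network k n) : ∃ g, IsMaximumLikelihood Ψ W s g :=
  Classical.skolem.1 fun y => Finite.exists_max fun f => outputProb Ψ W s f y

section ErrorProbability

variable [Fintype 𝒴] (D : ℝ)

section FixedNetwork

variable (s : Network k n) (g : (Fin n → 𝒴) → Field k)

theorem sum_outputProb (f : Field k) : ∑ y, outputProb Ψ W s f y = 1 := by
  classical
  unfold outputProb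
  rw [← Fintype.prod_sum fun l y => (W (Ψ (patternAt c f (s l))) y).toReal]
  simp only [sum_toReal_pmf_apply, prod_const_one]

theorem errorGiven_nonneg (f : Field k) : 0 ≤ errorGiven Ψ W D s g f := by
  refine sum_nonneg fun y _ => ?_
  split_ifs
  · exact le_rfl
  · exact outputProb_nonneg Ψ W s f y

theorem errorGiven_le_one (f : Field k) : errorGiven Ψ W D s g f ≤ 1 := by
  rw [← sum_outputProb Ψ W s f]
  refine sum_le_sum fun y _ => ?_
  split_ifs
  · exact outputProb_nonneg Ψ W s f y
  · exact le_rfl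

theorem expectedError_nonneg : 0 ≤ expectedError Ψ W D s g :=
  div_nonneg (sum_nonneg fun f _ => errorGiven_nonneg Ψ W D s g f) (Nat.cast_nonneg _)

end FixedNetwork

open scoped Classical in
theorem sum_errorGiven_eq_sum_jointType (g : Network k n → (Fin n → 𝒴) → Field k) (f : Field k) :
    ∑ s, errorGiven Ψ W D s (g s) f = ∑ q ∈ univ.image (jointType c f), ∑ y,
      ∑ s with ¬ Tolerable D f (g s y) ∧ jointType c f (g s y) = q, outputProb Ψ W s f y := by
  calc _ = ∑ y, ∑ s with ¬ Tolerable D f (g s y), outputProb Ψ W s f y := by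
        unfold errorGiven
        rw [sum_comm]
        simp only [sum_filter, ite_not]
    _ = ∑ y, ∑ q ∈ univ.image (jointType c f),
          ∑ s with ¬ Tolerable D f (g s y) ∧ jointType c f (g s y) = q, outputProb Ψ W s f y := by
        refine sum_congr rfl fun y _ => ?_
        rw [← sum_fiberwise_of_maps_to fun s _ =>
          mem_image_of_mem (jointType c f) (mem_univ (g s y))]
        simp only [filter_filter]
    _ = _ := sum_comm

theorem average_expectedError_le (hk : k ≠ 0) (g : Network k n → (Fin n → 𝒴) → Field k)
    (U : Finset (Field k)) {a b : ℝ} (hb : 0 ≤ b) (hU : #U ≤ a * Fintype.card (Field k))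
    (hf : ∀ f ∉ U, ∑ s, errorGiven Ψ W D s (g s) f ≤ Fintype.card (Network k n) * b) :
    (∑ s, expectedError Ψ W D s (g s)) / Fintype.card (Network k n) ≤ a + b := by
  classical
  have : NeZero k := ⟨hk⟩
  have hN : (0 : ℝ) < Fintype.card (Network k n) := Nat.cast_pos.2 Fintype.card_pos
  have hF : (0 : ℝ) < Fintype.card (Field k) := Nat.cast_pos.2 Fintype.card_pos
  have hfield : ∀ f, ∑ s, errorGiven Ψ W D s (g s) f ≤
      (if f ∈ U then (Fintype.card (Network k n) : ℝ) else 0) + Fintype.card (Network k n) * b := by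
    intro f
    split_ifs with h
    · have hone : ∑ s, errorGiven Ψ W D s (g s) f ≤ Fintype.card (Network k n) • (1 : ℝ) :=
        sum_le_card_nsmul _ _ _ fun s _ => errorGiven_le_one Ψ W D s (g s) f
      rw [nsmul_one] at hone
      exact hone.trans (le_add_of_nonneg_right (by positivity))
    · rw [zero_add]
      exact hf f h
  unfold expectedError
  rw [div_le_iff₀ hN, ← sum_div, div_le_iff₀ hF, sum_comm]
  calc ∑ f, ∑ s, errorGiven Ψ W D s (g s) f
      ≤ ∑ f, ((if f ∈ U then (Fintype.card (Network k n) : ℝ) else 0) +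
          Fintype.card (Network k n) * b) := sum_le_sum fun f _ => hfield f
    _ = #U * Fintype.card (Network k n) +
          Fintype.card (Field k) * (Fintype.card (Network k n) * b) := by
        rw [sum_add_distrib, sum_ite_mem, univ_inter, sum_const, sum_const, nsmul_eq_mul,
          nsmul_eq_mul, card_univ]
    _ ≤ a * Fintype.card (Field k) * Fintype.card (Network k n) +
          Fintype.card (Field k) * (Fintype.card (Network k n) * b) := by gcongr
    _ = _ := by ring

end ErrorProbability

theorem card_le_of_jointType_eq (hk : k ≠ 0) (f f₀ : Field k) (J : Finset (Field k))
    (hJ : ∀ f' ∈ J, jointType c f f' = jointType c f f₀) :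
    (#J : ℝ) ≤ 2 ^ ((k : ℝ) ^ 2 * entropyBits (bitFreq (sndType (jointType c f f₀)))) := by
  have hmem := jointType_mem_stdSimplex (c := c) hk f f₀
  have hcount : ∀ f' ∈ J, ∀ u, (#{h | f' h = u} : ℝ) =
      Fintype.card (Fin k × Fin k) * bitFreq (sndType (jointType c f f₀)) u := by
    intro f' hf' u
    rw [← hJ f' hf', bitFreq_sndType_jointType, Fintype.card_prod, Fintype.card_fin, Nat.cast_mul,
      ← sq, mul_div_cancel₀ _ (by positivity)]
  have hcard := card_le_two_rpow_entropyBits (bitFreq_nonneg (sndType_nonneg hmem.1))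
    (by rw [sum_bitFreq, sum_sndType, hmem.2]) J hcount
  simpa [sq] using hcard

theorem card_image_jointType_le [DecidableEq (Pattern c × Pattern c → ℝ)] (f : Field k) :
    #(univ.image (jointType c f)) ≤ (k ^ 2 + 1) ^ Fintype.card (Pattern c × Pattern c) := by
  classical
  have hsub : univ.image (jointType c f) ⊆ Fintype.piFinset fun _ =>
      (range (k ^ 2 + 1)).image fun m : ℕ => (m : ℝ) / (k : ℝ) ^ 2 := by
    refine image_subset_iff.2 fun f' _ => Fintype.mem_piFinset.2 fun p => ?_
    have hcard : #{h | patternAt c f h = p.1 ∧ patternAt c f' h = p.2} ≤ k ^ 2 :=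
      (card_le_univ _).trans_eq (by simp [sq])
    exact mem_image.2 ⟨_, mem_range.2 (Nat.lt_succ_of_le hcard), rfl⟩
  refine (card_le_card hsub).trans ?_
  rw [Fintype.card_piFinset, prod_const, card_univ]
  exact Nat.pow_le_pow_left (card_image_le.trans_eq (card_range _)) _

variable [DecidableEq 𝒳]

theorem outputMass_sensorProb_self (hk : k ≠ 0) (f f' : Field k) :
    outputMass (fun h => Ψ (patternAt c f h)) (sensorProb Ψ W f) =
      fun z => (k : ℝ) ^ 2 * distP Ψ W (fstType (jointType c f f')) z := by
  ext z
  rw [outputMass, distP_fstType_eq_sum_mul, sq_mul_sum_jointType_mul hk, ← sum_filter]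
  refine sum_congr rfl fun h hh => ?_
  rw [sensorProb, (mem_filter.1 hh).2]

variable [Fintype 𝒳]

theorem outputMass_sensorProb (hk : k ≠ 0) (f f' : Field k) :
    outputMass (fun h => Ψ (patternAt c f h)) (sensorProb Ψ W f') =
      fun z => (k : ℝ) ^ 2 * distQ Ψ W (jointType c f f') z := by
  ext z
  rw [outputMass, distQ_eq_sum_mul, sq_mul_sum_jointType_mul hk, ← sum_filter]
  rfl

variable [Fintype 𝒴] {ρ R θ : ℝ} {g : Network k n → (Fin n → 𝒴) → Field k}

theorem sum_outputProb_confused_le (hk : k ≠ 0) (hkn : (k : ℝ) ^ 2 ≤ n * R)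
    (hρ : ρ ∈ Set.Icc 0 1) (hg : ∀ s, IsMaximumLikelihood Ψ W s (g s)) (f f₀ : Field k)
    (J : Finset (Field k)) (hJ : ∀ f' ∈ J, jointType c f f' = jointType c f f₀) :
    ∑ y, ∑ s with g s y ∈ J, outputProb Ψ W s f y ≤
      Fintype.card (Network k n) * gallagerFactor Ψ W ρ R (jointType c f f₀) ^ n := by
  set q := jointType c f f₀
  set H := entropyBits (bitFreq (sndType q))
  have hq : q ∈ stdSimplex ℝ (Pattern c × Pattern c) := jointType_mem_stdSimplex hk f f₀
  have hH : 0 ≤ H := entropyBits_bitFreq_sndType_nonneg hq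
  have hchernoff := chernoffSum_nonneg (ρ := ρ) (distP_nonneg Ψ W hq.1) (distQ_nonneg Ψ W hq.1)
  have hcard : (#J : ℝ) ^ ρ ≤ (2 ^ (ρ * (R * H))) ^ n := by
    calc (#J : ℝ) ^ ρ ≤ (2 ^ ((k : ℝ) ^ 2 * H)) ^ ρ :=
          Real.rpow_le_rpow (Nat.cast_nonneg _) (card_le_of_jointType_eq hk f f₀ J hJ) hρ.1
      _ ≤ (2 ^ (n * R * H)) ^ ρ := by
          gcongr
          · exact hρ.1
          · exact one_le_two
      _ = (2 ^ (ρ * (R * H))) ^ n := by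
          rw [← Real.rpow_mul two_pos.le, ← Real.rpow_mul_natCast two_pos.le]
          ring_nf
  have hnetworks : (Fintype.card (Network k n) : ℝ) = ((k : ℝ) ^ 2) ^ n := by simp [sq]
  have hcoding := sum_likelihood_exceeded_le (sensorProb_nonneg Ψ W f) (sensorProb_nonneg Ψ W)
    (fun z => mul_nonneg (sq_nonneg (k : ℝ)) (distQ_nonneg Ψ W hq.1 z))
    (fun f' hf' => by rw [outputMass_sensorProb Ψ W hk f f', hJ f' hf']) hρ
    (fun y => {s : Network k n | g s y ∈ J})
    (fun y s hs => ⟨g s y, (mem_filter.1 hs).2, hg s y f⟩)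
  rw [outputMass_sensorProb_self Ψ W hk f f₀, chernoffSum_const_mul (distP_nonneg Ψ W hq.1)
    (distQ_nonneg Ψ W hq.1) (sq_nonneg _), mul_pow] at hcoding
  calc _ ≤ (#J : ℝ) ^ ρ * (((k : ℝ) ^ 2) ^ n *
          chernoffSum ρ (distP Ψ W (fstType q)) (distQ Ψ W q) ^ n) := hcoding
    _ ≤ (2 ^ (ρ * (R * H))) ^ n * (((k : ℝ) ^ 2) ^ n *
          chernoffSum ρ (distP Ψ W (fstType q)) (distQ Ψ W q) ^ n) := by gcongr
    _ = Fintype.card (Network k n) * gallagerFactor Ψ W ρ R q ^ n := by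
        rw [gallagerFactor, mul_pow, mul_left_comm, hnetworks]

theorem sum_errorGiven_le {D : ℝ} (hk : k ≠ 0) (hkn : (k : ℝ) ^ 2 ≤ n * R) (hθ : 0 ≤ θ)
    (hg : ∀ s, IsMaximumLikelihood Ψ W s (g s)) (f : Field k)
    (hf : ∀ f', ¬ Tolerable D f f' →
      ∃ ρ ∈ Set.Ioo 0 1, gallagerFactor Ψ W ρ R (jointType c f f') ≤ θ) :
    ∑ s, errorGiven Ψ W D s (g s) f ≤ Fintype.card (Network k n) *
      (((k : ℝ) ^ 2 + 1) ^ Fintype.card (Pattern c × Pattern c) * θ ^ n) := by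
  classical
  have hconfused : ∀ q, ∑ y, ∑ s with ¬ Tolerable D f (g s y) ∧ jointType c f (g s y) = q,
      outputProb Ψ W s f y ≤ Fintype.card (Network k n) * θ ^ n := by
    intro q
    rcases em (∃ f₀, ¬ Tolerable D f f₀ ∧ jointType c f f₀ = q) with ⟨f₀, hf₀, rfl⟩ | hnone
    · obtain ⟨ρ, hρ, hle⟩ := hf f₀ hf₀
      have hbound := sum_outputProb_confused_le Ψ W hk hkn ⟨hρ.1.le, hρ.2.le⟩ hg f f₀
        {f' | ¬ Tolerable D f f' ∧ jointType c f f' = jointType c f f₀}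
        fun f' hf' => (mem_filter.1 hf').2.2
      simp only [mem_filter, mem_univ, true_and] at hbound
      refine hbound.trans ?_
      gcongr
      exact gallagerFactor_nonneg Ψ W (jointType_nonneg f f₀)
    · have hempty : ∀ s y, ¬ (¬ Tolerable D f (g s y) ∧ jointType c f (g s y) = q) :=
        fun s y h => hnone ⟨g s y, h⟩
      simp only [hempty, filter_false, sum_empty, sum_const_zero]
      positivity
  rw [sum_errorGiven_eq_sum_jointType]
  calc _ ≤ #(univ.image (jointType c f)) • (Fintype.card (Network k n) * θ ^ n) :=
        sum_le_card_nsmul _ _ _ fun q _ => hconfused q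
    _ ≤ ((k ^ 2 + 1) ^ Fintype.card (Pattern c × Pattern c) : ℕ) •
          (Fintype.card (Network k n) * θ ^ n) := by
        gcongr
        exact card_image_jointType_le f
    _ = _ := by
        rw [nsmul_eq_mul, mul_left_comm]
        push_cast
        rfl

end MaximumLikelihood

section Asymptotics

theorem exists_uniform_lt_one_of_isCompact {X I : Type*} [TopologicalSpace X] {K : Set X}
    (hK : IsCompact K) {b : X → ℝ} (hb : Continuous b) {S : Set I} {G : I → X → ℝ}
    (hG : ∀ i ∈ S, Continuous (G i)) (hlt : ∀ x ∈ K, b x = 0 → ∃ i ∈ S, G i x < 1) :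
    ∃ δ > 0, ∃ θ ∈ Set.Ico (0 : ℝ) 1, ∀ x ∈ K, |b x| ≤ δ → ∃ i ∈ S, G i x ≤ θ := by
  refine hK.induction_on (p := fun s => ∃ δ > 0, ∃ θ ∈ Set.Ico (0 : ℝ) 1,
    ∀ x ∈ s, |b x| ≤ δ → ∃ i ∈ S, G i x ≤ θ) ⟨1, one_pos, 0, ⟨le_rfl, one_pos⟩, by simp⟩ ?_ ?_ ?_
  · rintro s t hst ⟨δ, hδ, θ, hθ, ht⟩
    exact ⟨δ, hδ, θ, hθ, fun x hx => ht x (hst hx)⟩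
  · rintro s t ⟨δ, hδ, θ, hθ, hs⟩ ⟨δ', hδ', θ', hθ', ht⟩
    refine ⟨min δ δ', lt_min hδ hδ', max θ θ', ⟨le_max_of_le_left hθ.1, max_lt hθ.2 hθ'.2⟩, ?_⟩
    rintro x (hx | hx) hbx
    · obtain ⟨i, hi, hle⟩ := hs x hx (hbx.trans (min_le_left _ _))
      exact ⟨i, hi, hle.trans (le_max_left _ _)⟩
    · obtain ⟨i, hi, hle⟩ := ht x hx (hbx.trans (min_le_right _ _))
      exact ⟨i, hi, hle.trans (le_max_right _ _)⟩
  · intro x hx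
    by_cases hbx : b x = 0
    · obtain ⟨i, hi, hix⟩ := hlt x hx hbx
      obtain ⟨θ, hθ, hθ1⟩ := exists_between (max_lt hix one_pos)
      refine ⟨{y | G i y < θ}, mem_nhdsWithin_of_mem_nhds
        ((hG i hi).continuousAt.eventually_lt_const ((le_max_left _ _).trans_lt hθ)), 1, one_pos, θ,
        ⟨(le_max_right _ _).trans hθ.le, hθ1⟩, fun y hy _ => ⟨i, hi, le_of_lt hy⟩⟩
    · obtain ⟨δ, hδ, hδx⟩ := exists_between (abs_pos.2 hbx)
      exact ⟨{y | δ < |b y|}, mem_nhdsWithin_of_mem_nhds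
        (hb.abs.continuousAt.eventually_const_lt hδx), δ, hδ, 0, ⟨le_rfl, one_pos⟩,
        fun y hy hle => absurd hle (not_le.2 hy)⟩

theorem tendsto_gridSide_sq_div {R : ℝ} (hR : 0 ≤ R) :
    Tendsto (fun n => (gridSide R n : ℝ) ^ 2 / n) atTop (𝓝 R) := by
  have hsqrt : Tendsto (fun n : ℕ => √(n : ℝ)) atTop atTop :=
    Real.tendsto_sqrt_atTop.comp tendsto_natCast_atTop_atTop
  have hceil := ((tendsto_nat_ceil_mul_div_atTop (Real.sqrt_nonneg R)).comp hsqrt).pow 2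
  rw [Real.sq_sqrt hR] at hceil
  refine hceil.congr fun n => ?_
  rw [Function.comp_apply, div_pow, Real.sq_sqrt n.cast_nonneg, gridSide,
    Real.sqrt_mul n.cast_nonneg, mul_comm]

theorem tendsto_gridSide_sq {R : ℝ} (hR : 0 < R) :
    Tendsto (fun n => (gridSide R n : ℝ) ^ 2) atTop atTop := by
  refine ((tendsto_gridSide_sq_div hR.le).pos_mul_atTop hR tendsto_natCast_atTop_atTop).congr' ?_
  filter_upwards [eventually_ne_atTop 0] with n hn
  exact div_mul_cancel₀ _ (Nat.cast_ne_zero.2 hn)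

theorem gridSide_ne_zero {R : ℝ} (hR : 0 < R) {n : ℕ} (hn : n ≠ 0) : gridSide R n ≠ 0 :=
  (Nat.ceil_pos.2 (Real.sqrt_pos.2 (by positivity))).ne'

theorem tendsto_gridSide_errorBound {R θ : ℝ} (δ : ℝ) (C : ℕ) (hR : 0 < R)
    (hθ : θ ∈ Set.Ico (0 : ℝ) 1) :
    Tendsto (fun n => 1 / (4 * δ ^ 2 * (gridSide R n : ℝ) ^ 2) +
      ((gridSide R n : ℝ) ^ 2 + 1) ^ C * θ ^ n) atTop (𝓝 0) := by
  have hunbalanced : Tendsto (fun n => 1 / (4 * δ ^ 2 * (gridSide R n : ℝ) ^ 2)) atTop (𝓝 0) := by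
    have h := (tendsto_gridSide_sq hR).inv_tendsto_atTop.const_mul (4 * δ ^ 2)⁻¹
    rw [mul_zero] at h
    exact h.congr fun n => by rw [Pi.inv_apply, one_div, mul_inv (4 * δ ^ 2)]
  have htypes : Tendsto (fun n => ((gridSide R n : ℝ) ^ 2 + 1) ^ C * θ ^ n) atTop (𝓝 0) := by
    have h := (((tendsto_gridSide_sq_div hR.le).add tendsto_one_div_atTop_nhds_zero_nat).pow C).mul
      (tendsto_pow_const_mul_const_pow_of_abs_lt_one C (abs_lt.2 ⟨by linarith [hθ.1], hθ.2⟩))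
    rw [mul_zero] at h
    refine h.congr' ?_
    filter_upwards [eventually_ne_atTop 0] with n hn
    rw [← mul_assoc, ← mul_pow, ← add_div, div_mul_cancel₀ _ (Nat.cast_ne_zero.2 hn)]
  simpa only [add_zero] using hunbalanced.add htypes

theorem EnsembleAchievable.achievable {𝒳 𝒴 : Type*} [Fintype 𝒴] {c : ℝ≥0} {Ψ : Pattern c → 𝒳}
    {W : 𝒳 → PMF 𝒴} {D R : ℝ} (hR : 0 < R) (h : EnsembleAchievable Ψ W D R) :
    Achievable Ψ W D R := by
  obtain ⟨g, hg⟩ := h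
  have hexists : ∀ n, ∃ s, expectedError Ψ W D s (g n s) ≤
      (∑ s, expectedError Ψ W D s (g n s)) / Fintype.card (Network (gridSide R n) n) := by
    intro n
    have : Nonempty (Network (gridSide R n) n) := by
      rcases eq_or_ne n 0 with rfl | hn
      · exact ⟨Fin.elim0⟩
      · have : NeZero (gridSide R n) := ⟨gridSide_ne_zero hR hn⟩
        exact ⟨fun _ => 0⟩
    obtain ⟨s, -, hs⟩ := exists_le_of_sum_le (s := univ) univ_nonempty
      (f := fun s => expectedError Ψ W D s (g n s))
      (g := fun _ => (∑ s, expectedError Ψ W D s (g n s)) /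
        Fintype.card (Network (gridSide R n) n)) (by
        rw [sum_const, card_univ, nsmul_eq_mul, mul_div_cancel₀]
        exact Nat.cast_ne_zero.2 Fintype.card_ne_zero)
    exact ⟨s, hs⟩
  choose s hs using hexists
  exact ⟨s, fun n => g n (s n),
    squeeze_zero (fun n => expectedError_nonneg Ψ W D (s n) (g n (s n))) hs hg⟩

variable {𝒳 𝒴 : Type*} [Fintype 𝒳] [DecidableEq 𝒳] [Fintype 𝒴] {c : ℝ≥0} (Ψ : Pattern c → 𝒳)
  (W : 𝒳 → PMF 𝒴) {D R R' : ℝ}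

theorem exists_uniform_gallagerFactor_le (hR : 0 ≤ R)
    (hlt : ∀ q ∈ feasibleTypes c D, ENNReal.ofReal R < boundRatio Ψ W q) :
    ∃ δ > 0, ∃ θ ∈ Set.Ico (0 : ℝ) 1, ∀ q ∈ jointTypes c,
      D ≤ jointBitFreq q 0 1 + jointBitFreq q 1 0 → |bitFreq (fstType q) 0 - 1 / 2| ≤ δ →
      ∃ ρ ∈ Set.Ioo 0 1, gallagerFactor Ψ W ρ R q ≤ θ := by
  have hcompact : IsCompact (jointTypes c ∩ {q | D ≤ jointBitFreq q 0 1 + jointBitFreq q 1 0}) :=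
    isCompact_jointTypes.inter_right (isClosed_le continuous_const
      ((continuous_jointBitFreq 0 1).add (continuous_jointBitFreq 1 0)))
  have hlt_one : ∀ q ∈ jointTypes c ∩ {q | D ≤ jointBitFreq q 0 1 + jointBitFreq q 1 0},
      bitFreq (fstType q) 0 - 1 / 2 = 0 → ∃ ρ ∈ Set.Ioo 0 1, gallagerFactor Ψ W ρ R q < 1 := by
    rintro q ⟨hq, hqD⟩ hb
    have hsimplex := jointTypes_subset_stdSimplex hq
    have hsum := sum_bitFreq (fstType q)
    rw [sum_fstType, hsimplex.2, Fin.sum_univ_two] at hsum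
    exact (ofReal_lt_boundRatio_iff Ψ W hsimplex hR).1 (hlt q ⟨hq, hqD, by linarith, by linarith⟩)
  obtain ⟨δ, hδ, θ, hθ, h⟩ := exists_uniform_lt_one_of_isCompact hcompact
    ((continuous_bitFreq_fstType 0).sub continuous_const)
    (fun ρ hρ => continuous_gallagerFactor Ψ W hρ) hlt_one
  exact ⟨δ, hδ, θ, hθ, fun q hq hD => h q ⟨hq, hD⟩⟩

theorem average_expectedError_isMaximumLikelihood_le {k n : ℕ} {δ θ : ℝ} (hk : k ≠ 0)
    (hkn : (k : ℝ) ^ 2 ≤ n * R) (hδ : 0 < δ) (hθ : 0 ≤ θ)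
    (hexp : ∀ q ∈ jointTypes c, D ≤ jointBitFreq q 0 1 + jointBitFreq q 1 0 →
      |bitFreq (fstType q) 0 - 1 / 2| ≤ δ → ∃ ρ ∈ Set.Ioo 0 1, gallagerFactor Ψ W ρ R q ≤ θ)
    {g : Network k n → (Fin n → 𝒴) → Field k} (hg : ∀ s, IsMaximumLikelihood Ψ W s (g s)) :
    (∑ s, expectedError Ψ W D s (g s)) / Fintype.card (Network k n) ≤
      1 / (4 * δ ^ 2 * (k : ℝ) ^ 2) +
        ((k : ℝ) ^ 2 + 1) ^ Fintype.card (Pattern c × Pattern c) * θ ^ n := by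
  classical
  have : NeZero k := ⟨hk⟩
  have hpositions : (Fintype.card (Fin k × Fin k) : ℝ) = (k : ℝ) ^ 2 := by simp [sq]
  have hunbalanced := card_unbalanced_le (ι := Fin k × Fin k) hδ
  rw [hpositions] at hunbalanced
  refine average_expectedError_le Ψ W D hk g _
    (mul_nonneg (pow_nonneg (by positivity) _) (pow_nonneg hθ n)) hunbalanced
    fun f hf => sum_errorGiven_le Ψ W hk hkn hθ hg f fun f' hf' =>
      hexp _ (jointType_mem_jointTypes hk f f') ?_ ?_
  · rw [jointBitFreq_jointType]
    exact not_lt.1 hf'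
  · rw [bitFreq_fstType_jointType]
    rw [mem_filter_univ, not_lt] at hf
    exact hf

theorem ensembleAchievable_of_lt_boundRatio (hR : 0 < R) (hRR' : R < R')
    (hlt : ∀ q ∈ feasibleTypes c D, ENNReal.ofReal R' < boundRatio Ψ W q) :
    EnsembleAchievable Ψ W D R := by
  obtain ⟨δ, hδ, θ, hθ, hexp⟩ := exists_uniform_gallagerFactor_le Ψ W (hR.trans hRR').le hlt
  choose g hg using fun n (s : Network (gridSide R n) n) => exists_isMaximumLikelihood Ψ W s
  refine ⟨g, squeeze_zero' (.of_forall fun n => ?_) ?_ (tendsto_gridSide_errorBound δ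
    (Fintype.card (Pattern c × Pattern c)) hR hθ)⟩
  · exact div_nonneg (sum_nonneg fun s _ => expectedError_nonneg Ψ W D s (g n s))
      (Nat.cast_nonneg _)
  filter_upwards [eventually_gt_atTop 0,
    (tendsto_gridSide_sq_div hR.le).eventually_le_const hRR'] with n hn hrate
  rw [div_le_iff₀' (Nat.cast_pos.2 hn)] at hrate
  exact average_expectedError_isMaximumLikelihood_le Ψ W (gridSide_ne_zero hR hn.ne') hrate hδ hθ.1
    hexp (hg n)

end Asymptotics

end SensorField

theorem mainTheorem4 {𝒳 𝒴 : Type*} [Fintype 𝒳] [DecidableEq 𝒳] [Fintype 𝒴]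
    (c : ℝ≥0) (Ψ : SensorField.Pattern c → 𝒳) (W : 𝒳 → PMF 𝒴)
    (D : ℝ) (hD0 : 0 ≤ D) (hD1 : D ≤ 1) :
    ∃ m : ℝ≥0∞,
      IsLeast (SensorField.boundRatio Ψ W '' SensorField.feasibleTypes c D) m ∧
      m ≤ SensorField.sensingCapacity Ψ W D ∧
      ∀ R : ℝ, 0 < R → ENNReal.ofReal R < m → SensorField.EnsembleAchievable Ψ W D R := by
  obtain ⟨m, hm⟩ := SensorField.exists_isLeast_boundRatio Ψ W hD1
  have hach : ∀ R : ℝ, 0 < R → ENNReal.ofReal R < m →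
      SensorField.EnsembleAchievable Ψ W D R := by
    intro R hR hlt
    obtain ⟨R', -, hRR', hR'⟩ := ENNReal.lt_iff_exists_real_btwn.1 hlt
    exact SensorField.ensembleAchievable_of_lt_boundRatio Ψ W hR
      (ENNReal.ofReal_lt_ofReal_iff'.1 hRR').1 fun q hq => hR'.trans_le (hm.2 ⟨q, hq, rfl⟩)
  exact ⟨m, hm, le_sSup fun R hR hlt => (hach R hR hlt).achievable hR, hach⟩
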